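/- Let $\mathbb T=\mathbb R/\mathbb Z$, let $\mathcal S'(\mathbb T)$ be the topological dual of the Fréchet space $\mathcal S(\mathbb T)=C^\infty(\mathbb T)$, and write $\widehat f_k=\langle f,e^{-2\pi i k\cdot}\rangle$ for $f\in\mathcal S'(\mathbb T)$, $k\in\mathbb Z$. Fix nonnegative Schwartz functions $\varphi_0,\varphi$ on $\mathbb R$ with $\operatorname{supp}\varphi_0\subset\{|x|\le 2\}$, $\operatorname{supp}\varphi\subset\{\tfrac12\le|x|\le 2\}$ and $\sum_{j\ge0}\varphi_j=1$, where $\varphi_j=\varphi(2^{-j}\cdot)$ for $j\ge1$, and put $f_j(x)=\sum_{k\in\mathbb Z}\varphi_j(k)\widehat f_k e^{2\pi i kx}$. For $0<p,q\le\infty$ and $s\in\mathbb R$ define the spaces $B^s_{p,q}(\mathbb T)$ and $F^s_{p,q}(\mathbb T)$ as the sets of $f\in\mathcal S'(\mathbb T)$ with finite (quasi-)norm, where - $\|f\|_{B^s_{p,q}}=\bigl\|\bigl(2^{js}\|f_j\|_{L_p(\mathbb T)}\bigr)_{j\ge0}\bigr\|_{\ell_q}$; - $\|f\|_{F^s_{p,q}}=\bigl\|x\mapsto\|(2^{js}|f_j(x)|)_{j\ge0}\|_{\ell_q}\bigr\|_{L_p(\mathbb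 T)}$ if $p<\infty$; - $\|f\|_{F^s_{\infty,q}}=\sup_{J\in\mathbb N_0,\,m\in\mathbb Z}\Bigl(2^J\int_{m2^{-J}}^{(m+1)2^{-J}}\sum_{j\ge J}2^{jsq}|f_j(x)|^q\,dx\Bigr)^{1/q}$ if $q<\infty$, and $F^s_{\infty,\infty}=B^s_{\infty,\infty}$. For $f\in\mathcal S'(\mathbb T)$ let $$s_f(p,q)=\sup\{s\in\mathbb R: f\in B^s_{p,q}(\mathbb T)\},\qquad \tilde s_f(p,q)=\sup\{s\in\mathbb R: f\in F^s_{p,q}(\mathbb T)\},\qquad s_f(p)=s_f(p,p).$$ **Proposition.** For every $f\in\mathcal S'(\mathbb T)$ and all $0<p,q\le\infty$, one has $\tilde s_f(p,q)\in(-\infty,\infty]$ and $$\tilde s_f(p,q)=s_f(p,q)=s_f(p).$$ In particular $s_f(p,q)$ does not depend on $q$. -/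

import Mathlib

open MeasureTheory Set
open scoped ENNReal ContDiff

noncomputable section

namespace PeriodicSpaces

/-! ### Smooth periodic functions and periodic generalized functions -/

/-- The `1`-periodic infinitely smooth functions `ℝ → ℂ`, that is, the smooth functions on the
torus `𝕋 = ℝ / ℤ`. -/
def smoothPeriodic : Submodule ℂ (ℝ → ℂ) where
  carrier := {g | ContDiff ℝ ∞ g ∧ Function.Periodic g 1}
  zero_mem' := ⟨contDiff_const, fun _ => rfl⟩
  add_mem' := fun ha hb => ⟨ha.1.add hb.1, ha.2.add hb.2⟩
  smul_mem' := fun c g hg => ⟨hg.1.const_smul c, fun x => by simp [hg.2 x]⟩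

/-- The space `𝒮(𝕋)`. It is a type of its own, so that it carries only the Fréchet topology
defined below (and not the topology of pointwise convergence). -/
def TestFun : Type := ↥smoothPeriodic

instance : AddCommGroup TestFun := inferInstanceAs (AddCommGroup ↥smoothPeriodic)

instance : Module ℂ TestFun := inferInstanceAs (Module ℂ ↥smoothPeriodic)

/-- The function `ℝ → ℂ` underlying an element of `𝒮(𝕋)`. -/
def TestFun.toFun (g : TestFun) : ℝ → ℂ := g.1

theorem TestFun.contDiff (g : TestFun) : ContDiff ℝ ∞ g.toFun := g.2.1

theorem TestFun.periodic (g : TestFun) : Function.Periodic g.toFun 1 := g.2.2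

theorem TestFun.bddAbove (k : ℕ) (g : TestFun) :
    BddAbove (range fun x : ℝ => ‖iteratedDeriv k g.toFun x‖) := by
  have hc : Continuous (iteratedDeriv k g.toFun) :=
    g.contDiff.continuous_iteratedDeriv k (by exact_mod_cast le_top)
  have hp : Function.Periodic (fun x => ‖iteratedDeriv k g.toFun x‖) 1 := by
    intro x
    have h := congrFun (iteratedDeriv_comp_add_const k g.toFun 1) x
    have h2 : (fun z => g.toFun (z + 1)) = g.toFun := funext g.periodic
    rw [h2] at h
    simp only [h]
  have hr : (range fun x : ℝ => ‖iteratedDeriv k g.toFun x‖) =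
      (fun x : ℝ => ‖iteratedDeriv k g.toFun x‖) '' Icc 0 (0 + 1) :=
    (hp.image_Icc one_pos 0).symm
  rw [hr]
  exact (isCompact_Icc.image hc.norm).bddAbove

/-- The seminorm `g ↦ sup_x |g⁽ᵏ⁾(x)|` on `𝒮(𝕋)`. -/
def testSeminorm (k : ℕ) : Seminorm ℂ TestFun :=
  Seminorm.of (fun g => ⨆ x : ℝ, ‖iteratedDeriv k g.toFun x‖)
    (by
      intro f g
      refine ciSup_le fun x => ?_
      have h : iteratedDeriv k (f + g).toFun x =
          iteratedDeriv k f.toFun x + iteratedDeriv k g.toFun x :=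
        iteratedDeriv_add
          ((f.contDiff.of_le (by exact_mod_cast le_top)).contDiffAt)
          ((g.contDiff.of_le (by exact_mod_cast le_top)).contDiffAt)
      rw [h]
      exact (norm_add_le _ _).trans
        (add_le_add (le_ciSup (f.bddAbove k) x) (le_ciSup (g.bddAbove k) x)))
    (by
      intro c g
      have h : ∀ x, iteratedDeriv k (c • g).toFun x = c • iteratedDeriv k g.toFun x :=
        fun x => iteratedDeriv_const_smul_field c g.toFun
      simp only [h, norm_smul]
      exact (Real.mul_iSup_of_nonneg (norm_nonneg c) _).symm)

theorem testSeminorm_apply (k : ℕ) (g : TestFun) :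
    testSeminorm k g = ⨆ x : ℝ, ‖iteratedDeriv k g.toFun x‖ := rfl

/-- The usual Fréchet topology of `𝒮(𝕋)`: uniform convergence of all derivatives. -/
instance : TopologicalSpace TestFun :=
  (SeminormFamily.moduleFilterBasis (𝕜 := ℂ) (F := TestFun) testSeminorm).topology

theorem testFun_withSeminorms : WithSeminorms (𝕜 := ℂ) (E := TestFun) testSeminorm := ⟨rfl⟩

/-- The space `𝒮'(𝕋)` of periodic generalized functions, the topological dual of `𝒮(𝕋)`. -/
abbrev GenFun : Type := TestFun →L[ℂ] ℂ

/-- The character `x ↦ exp (2 π i k x)` as an element of `𝒮(𝕋)`. -/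
def character (k : ℤ) : TestFun :=
  ⟨fun x : ℝ => Complex.exp (2 * Real.pi * Complex.I * k * x), by
    constructor
    · have h : ContDiff ℝ ∞ (fun x : ℝ => (x : ℂ)) := Complex.ofRealCLM.contDiff
      exact (contDiff_const.mul h).cexp
    · intro x
      have h : (2 * Real.pi * Complex.I * k * ((x + 1 : ℝ) : ℂ)) =
          2 * Real.pi * Complex.I * k * x + k * (2 * Real.pi * Complex.I) := by
        push_cast; ring
      simp only [h, Complex.exp_add, Complex.exp_int_mul_two_pi_mul_I, mul_one]⟩

/-- The Fourier coefficient `f̂ₖ = ⟨f, exp (-2 π i k ·)⟩`. -/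
def fourierCoefficient (f : GenFun) (k : ℤ) : ℂ := f (character (-k))

/-! ### Dyadic resolutions of unity -/

/-- A smooth dyadic resolution of unity on `ℝ`: nonnegative Schwartz functions `φ₀` and `φ`, with
`φ₀` supported in `|x| ≤ 2` and `φ` supported in `1/2 ≤ |x| ≤ 2`, such that
`φ₀ + ∑_{j ≥ 1} φ (2⁻ʲ ·) = 1`. -/
structure DyadicSystem where
  low : SchwartzMap ℝ ℝ
  gen : SchwartzMap ℝ ℝ
  low_nonneg : ∀ x, 0 ≤ low x
  gen_nonneg : ∀ x, 0 ≤ gen x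
  tsupport_low : tsupport (low : ℝ → ℝ) ⊆ {x | |x| ≤ 2}
  tsupport_gen : tsupport (gen : ℝ → ℝ) ⊆ {x | 1 / 2 ≤ |x| ∧ |x| ≤ 2}
  hasSum_one : ∀ x : ℝ,
    HasSum (fun j : ℕ => if j = 0 then low x else gen ((2 : ℝ) ^ (-(j : ℤ)) * x)) 1

/-- The `j`-th function of the system: `φ₀` for `j = 0`, and `φⱼ = φ (2⁻ʲ ·)` for `j ≥ 1`. -/
def DyadicSystem.piece (φ : DyadicSystem) (j : ℕ) (x : ℝ) : ℝ :=
  if j = 0 then φ.low x else φ.gen ((2 : ℝ) ^ (-(j : ℤ)) * x)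

/-- The dyadic block `x ↦ ∑ₖ φⱼ(k) f̂ₖ exp (2 π i k x)`; only finitely many terms are nonzero. -/
def block (φ : DyadicSystem) (f : GenFun) (j : ℕ) (x : ℝ) : ℂ :=
  ∑' k : ℤ, (φ.piece j k : ℂ) * fourierCoefficient f k * (character k).toFun x

/-- Lebesgue measure on the fundamental domain `(0, 1]` of the torus. -/
def torusMeasure : Measure ℝ := volume.restrict (Ioc 0 1)

/-- The `ℓ_q` (quasi-)norm, `0 < q ≤ ∞`, of a sequence of extended nonnegative numbers. -/
def seqNorm (q : ℝ≥0∞) (a : ℕ → ℝ≥0∞) : ℝ≥0∞ :=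
  if q = ⊤ then ⨆ j, a j else (∑' j, a j ^ q.toReal) ^ (1 / q.toReal)

/-! ### Besov spaces -/

/-- The (extended) `B^s_{p,q}(𝕋)` (quasi-)norm. -/
def besovNorm (φ : DyadicSystem) (p q : ℝ≥0∞) (s : ℝ) (f : GenFun) : ℝ≥0∞ :=
  seqNorm q fun j => (2 : ℝ≥0∞) ^ ((j : ℝ) * s) * eLpNorm (block φ f j) p torusMeasure

/-- The Besov space `B^s_{p,q}(𝕋)`. -/
def besovSpace (φ : DyadicSystem) (p q : ℝ≥0∞) (s : ℝ) : Set GenFun :=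
  {f | besovNorm φ p q s f < ⊤}

/-! ### Triebel–Lizorkin spaces -/

/-- The (extended) `F^s_{p,q}(𝕋)` (quasi-)norm.
* For `p < ∞` it is the `L_p` norm of `x ↦ ‖(2^{js} |fⱼ(x)|)_j‖_{ℓ_q}`, `fⱼ` the dyadic blocks.
* For `p = ∞` and `q < ∞` it is the usual Carleson-type supremum over the dyadic intervals
  `(m 2^{-J}, (m+1) 2^{-J}]` of length at most one.
* For `p = q = ∞` it is the norm of `B^s_{∞,∞}(𝕋)`. -/
def triebelLizorkinNorm (φ : DyadicSystem) (p q : ℝ≥0∞) (s : ℝ) (f : GenFun) : ℝ≥0∞ :=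
  if p = ⊤ then
    if q = ⊤ then besovNorm φ ⊤ ⊤ s f
    else ⨆ (J : ℕ) (m : ℤ),
      ((2 : ℝ≥0∞) ^ J *
        ∫⁻ x in Ioc ((m : ℝ) / 2 ^ J) (((m : ℝ) + 1) / 2 ^ J),
          ∑' j : ℕ, if J ≤ j
            then ((2 : ℝ≥0∞) ^ ((j : ℝ) * s) * ‖block φ f j x‖ₑ) ^ q.toReal else 0)
        ^ (1 / q.toReal)
  else
    (∫⁻ x, (seqNorm q fun j => (2 : ℝ≥0∞) ^ ((j : ℝ) * s) * ‖block φ f j x‖ₑ) ^ p.toReal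
      ∂torusMeasure) ^ (1 / p.toReal)

/-- The Triebel–Lizorkin space `F^s_{p,q}(𝕋)`. -/
def triebelLizorkinSpace (φ : DyadicSystem) (p q : ℝ≥0∞) (s : ℝ) : Set GenFun :=
  {f | triebelLizorkinNorm φ p q s f < ⊤}

/-! ### Critical smoothness -/

/-- The `(p,q)`-critical smoothness `s_f(p,q) = sup {s ∈ ℝ : f ∈ B^s_{p,q}(𝕋)}`. -/
def besovCritical (φ : DyadicSystem) (f : GenFun) (p q : ℝ≥0∞) : EReal :=
  sSup ((fun s : ℝ => (s : EReal)) '' {s : ℝ | f ∈ besovSpace φ p q s})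

/-- The critical smoothness `s_f(p)`. It is the common value of all the `s_f(p,q)`, `0 < q ≤ ∞`,
represented here by the one with `q = p`. -/
def criticalSmoothness (φ : DyadicSystem) (f : GenFun) (p : ℝ≥0∞) : EReal :=
  besovCritical φ f p p

/-- The Triebel–Lizorkin critical smoothness `sup {s ∈ ℝ : f ∈ F^s_{p,q}(𝕋)}`. -/
def triebelLizorkinCritical (φ : DyadicSystem) (f : GenFun) (p q : ℝ≥0∞) : EReal :=
  sSup ((fun s : ℝ => (s : EReal)) '' {s : ℝ | f ∈ triebelLizorkinSpace φ p q s})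

end PeriodicSpaces

end

open MeasureTheory Set
open scoped ENNReal ContDiff

namespace PeriodicSpaces

/-! ### Sequence quasi-norms -/

/-! All the numbers compared are suprema of sets of `s`, so it suffices that membership at `s` in
one space gives membership at every `t < s` in the other (`sSup_coe_image_le`). An arbitrarily small
loss of smoothness produces the factor `2^{j(t-s)}`, which lies in every `ℓ_q`; hence a bound
uniform in `j` controls every fine index (`seqNorm_weight_le`).

For `p < ∞`, B and F coincide when `q = p`, by Tonelli, and changing `q` costs only smoothness, on
either scale. For `p = ∞`, sup norms of the blocks bound the Carleson averages trivially. The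
converse is the substantial step, `weight_mul_eLpNorm_top_le`: block `J` is a trigonometric
polynomial of degree at most `2^{J+1}`, so by Bernstein it stays above half its maximum on an
interval of length comparable to `2^{-J}`, and its average over a dyadic interval of that scale sees
the maximum.

The critical exponent exceeds `-∞` because a continuous functional has polynomially growing Fourier
coefficients (`exists_norm_block_le`). -/

theorem le_seqNorm {q : ℝ≥0∞} (hq : 0 < q) (a : ℕ → ℝ≥0∞) (j : ℕ) : a j ≤ seqNorm q a := by
  unfold seqNorm
  split_ifs with h
  · exact le_iSup a j
  · have h0 : 0 < q.toReal := ENNReal.toReal_pos hq.ne' h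
    rw [one_div, ENNReal.le_rpow_inv_iff h0]
    exact ENNReal.le_tsum j

theorem seqNorm_mono (q : ℝ≥0∞) {a b : ℕ → ℝ≥0∞} (h : ∀ j, a j ≤ b j) :
    seqNorm q a ≤ seqNorm q b := by
  unfold seqNorm
  split_ifs
  · exact iSup_mono h
  · gcongr with j
    exact h j

theorem seqNorm_mul_const {q : ℝ≥0∞} (hq : 0 < q) (a : ℕ → ℝ≥0∞) (c : ℝ≥0∞) :
    seqNorm q (fun j => a j * c) = seqNorm q a * c := by
  unfold seqNorm
  split_ifs with h
  · rw [ENNReal.iSup_mul]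
  · have h0 : 0 < q.toReal := ENNReal.toReal_pos hq.ne' h
    simp_rw [ENNReal.mul_rpow_of_nonneg _ _ h0.le]
    rw [ENNReal.tsum_mul_right, ENNReal.mul_rpow_of_nonneg _ _ (by positivity), one_div,
      ENNReal.rpow_rpow_inv h0.ne']

theorem seqNorm_two_rpow_lt_top {q : ℝ≥0∞} (hq : 0 < q) {r : ℝ} (hr : r < 0) :
    seqNorm q (fun j => (2 : ℝ≥0∞) ^ ((j : ℝ) * r)) < ⊤ := by
  unfold seqNorm
  split_ifs with h
  · refine (iSup_le fun j => ?_).trans_lt ENNReal.one_lt_top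
    rw [← ENNReal.rpow_zero (x := 2)]
    exact ENNReal.rpow_le_rpow_of_exponent_le (by norm_num)
      (mul_nonpos_of_nonneg_of_nonpos j.cast_nonneg hr.le)
  · have h0 : 0 < q.toReal := ENNReal.toReal_pos hq.ne' h
    refine ENNReal.rpow_lt_top_of_nonneg (by positivity) ?_
    have e : ∀ j : ℕ, ((2 : ℝ≥0∞) ^ ((j : ℝ) * r)) ^ q.toReal = ((2 : ℝ≥0∞) ^ (r * q.toReal)) ^ j := by
      intro j
      rw [← ENNReal.rpow_mul, ← ENNReal.rpow_natCast, ← ENNReal.rpow_mul]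
      congr 1
      ring
    simp_rw [e]
    rw [ENNReal.tsum_geometric]
    refine ENNReal.inv_ne_top.2 (tsub_pos_of_lt ?_).ne'
    exact ENNReal.rpow_lt_one_of_one_lt_of_neg (by norm_num) (mul_neg_of_neg_of_pos hr h0)

theorem two_rpow_add (x y : ℝ) : (2 : ℝ≥0∞) ^ (x + y) = 2 ^ x * 2 ^ y :=
  ENNReal.rpow_add x y (by norm_num) (by norm_num)

/-- Lowering the smoothness index makes the fine index of a weighted sequence norm irrelevant. -/
theorem seqNorm_weight_le {q : ℝ≥0∞} (hq : 0 < q) {s t : ℝ} {b : ℕ → ℝ≥0∞} {S : ℝ≥0∞}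
    (hS : ∀ j : ℕ, (2 : ℝ≥0∞) ^ ((j : ℝ) * s) * b j ≤ S) :
    seqNorm q (fun j => (2 : ℝ≥0∞) ^ ((j : ℝ) * t) * b j) ≤
      seqNorm q (fun j => (2 : ℝ≥0∞) ^ ((j : ℝ) * (t - s))) * S := by
  rw [← seqNorm_mul_const hq]
  refine seqNorm_mono q fun j => ?_
  have e : (j : ℝ) * t = j * (t - s) + j * s := by ring
  rw [e, two_rpow_add, mul_assoc]
  gcongr
  exact hS j

/-! ### A Bernstein inequality -/

/-- Maximum modulus principle on the unit disc. -/
theorem norm_sum_mul_pow_le {n : ℕ} {a : ℕ → ℂ} {M : ℝ}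
    (h : ∀ z : ℂ, ‖z‖ = 1 → ‖∑ i ∈ Finset.range (n + 1), a i * z ^ i‖ ≤ M) {z : ℂ}
    (hz : ‖z‖ ≤ 1) : ‖∑ i ∈ Finset.range (n + 1), a i * z ^ i‖ ≤ M := by
  have hd : Differentiable ℂ fun z : ℂ => ∑ i ∈ Finset.range (n + 1), a i * z ^ i := by fun_prop
  refine Complex.norm_le_of_forall_mem_frontier_norm_le (U := Metric.ball (0 : ℂ) 1)
    (f := fun z : ℂ => ∑ i ∈ Finset.range (n + 1), a i * z ^ i)
    Metric.isBounded_ball hd.diffContOnCl ?_ ?_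
  · intro w hw
    rw [frontier_ball _ one_ne_zero] at hw
    exact h w (by simpa using hw)
  · rw [closure_ball _ one_ne_zero]
    simpa using hz

/-- Reversing the coefficients writes the polynomial as `z ^ n` times a polynomial in `z⁻¹`, to
which the bound inside the disc applies. -/
theorem norm_sum_mul_pow_le_of_one_le {n : ℕ} {a : ℕ → ℂ} {M : ℝ}
    (h : ∀ z : ℂ, ‖z‖ = 1 → ‖∑ i ∈ Finset.range (n + 1), a i * z ^ i‖ ≤ M) {z : ℂ}
    (hz : 1 ≤ ‖z‖) : ‖∑ i ∈ Finset.range (n + 1), a i * z ^ i‖ ≤ M * ‖z‖ ^ n := by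
  have key : ∀ z : ℂ, z ≠ 0 → ∑ i ∈ Finset.range (n + 1), a i * z ^ i =
      z ^ n * ∑ i ∈ Finset.range (n + 1), a (n - i) * (z⁻¹) ^ i := by
    intro z hz
    rw [← Finset.sum_range_reflect, Finset.mul_sum]
    refine Finset.sum_congr rfl fun i hi => ?_
    have hi' : i ≤ n := by simpa [Nat.lt_succ_iff] using hi
    have e : n + 1 - 1 - i = n - i := by omega
    rw [e, pow_sub₀ _ hz hi', inv_pow]
    ring
  have hz0 : z ≠ 0 := norm_pos_iff.1 (by linarith)
  rw [key z hz0, norm_mul, norm_pow, mul_comm]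
  gcongr
  refine norm_sum_mul_pow_le (a := fun i => a (n - i)) (fun w hw => ?_) ?_
  · have hw0 : w ≠ 0 := norm_pos_iff.1 (by linarith)
    have := h w⁻¹ (by simp [hw])
    rwa [key _ (inv_ne_zero hw0), norm_mul, norm_pow, norm_inv, hw, inv_inv, inv_one, one_pow,
      one_mul] at this
  · rw [norm_inv]
    exact inv_le_one_of_one_le₀ hz

theorem one_add_inv_pow_le_three {n : ℕ} (hn : 0 < n) : (1 + (n : ℝ)⁻¹) ^ n ≤ 3 := by
  have h1 : 1 + (n : ℝ)⁻¹ ≤ Real.exp (n : ℝ)⁻¹ := by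
    linarith [Real.add_one_le_exp (n : ℝ)⁻¹]
  calc (1 + (n : ℝ)⁻¹) ^ n ≤ Real.exp (n : ℝ)⁻¹ ^ n := by gcongr
    _ = Real.exp 1 := by
      rw [← Real.exp_nat_mul, mul_inv_cancel₀ (by positivity)]
    _ ≤ 3 := by linarith [Real.exp_one_lt_d9]

/-- A polynomial of degree at most `n` bounded by `M` on the unit circle is `3nM`-Lipschitz on the
closed unit disc. -/
theorem norm_sum_mul_pow_sub_le {n : ℕ} (hn : 0 < n) {a : ℕ → ℂ} {M : ℝ}
    (h : ∀ z : ℂ, ‖z‖ = 1 → ‖∑ i ∈ Finset.range (n + 1), a i * z ^ i‖ ≤ M) {z w : ℂ}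
    (hz : ‖z‖ ≤ 1) (hw : ‖w‖ ≤ 1) :
    ‖∑ i ∈ Finset.range (n + 1), a i * z ^ i - ∑ i ∈ Finset.range (n + 1), a i * w ^ i‖ ≤
      3 * n * M * ‖z - w‖ := by
  set P : ℂ → ℂ := fun z => ∑ i ∈ Finset.range (n + 1), a i * z ^ i with hP
  have hd : Differentiable ℂ P := by fun_prop
  have hM : 0 ≤ M := (norm_nonneg _).trans (h 1 (by simp))
  -- Enlarging the disc by `1/n` costs only the factor `(1 + 1/n)^n ≤ 3`; Cauchy's estimate on
  -- circles of radius `1/n` then gives `3nM` for the derivative.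
  have hbound : ∀ v : ℂ, ‖v‖ ≤ 1 + (n : ℝ)⁻¹ → ‖P v‖ ≤ M * 3 := by
    intro v hv
    rcases le_total ‖v‖ 1 with h1 | h1
    · exact (norm_sum_mul_pow_le h h1).trans (by linarith)
    · refine (norm_sum_mul_pow_le_of_one_le h h1).trans ?_
      gcongr
      exact (pow_le_pow_left₀ (norm_nonneg _) hv n).trans (one_add_inv_pow_le_three hn)
  have hderiv : ∀ v ∈ Metric.closedBall (0 : ℂ) 1, ‖deriv P v‖ ≤ 3 * n * M := by
    intro v hv
    have hv' : ‖v‖ ≤ 1 := by simpa using hv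
    have := Complex.norm_deriv_le_of_forall_mem_sphere_norm_le (f := P) (c := v) (C := M * 3)
      (R := (n : ℝ)⁻¹) (by positivity) hd.diffContOnCl (fun u hu => hbound u (by
        have h1 : ‖u - v‖ = (n : ℝ)⁻¹ := by simpa [dist_eq_norm] using hu
        calc ‖u‖ = ‖v + (u - v)‖ := by congr 1; ring
          _ ≤ ‖v‖ + ‖u - v‖ := norm_add_le _ _
          _ ≤ _ := by rw [h1]; gcongr))
    rw [div_inv_eq_mul] at this
    linarith
  exact (convex_closedBall (0 : ℂ) 1).norm_image_sub_le_of_norm_deriv_le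
    (fun v _ => hd v) hderiv (by simpa using hw) (by simpa using hz)

theorem character_toFun (k : ℤ) (x : ℝ) : (character k).toFun x =
    Complex.exp (2 * Real.pi * Complex.I * k * x) := rfl

theorem norm_exp_two_pi_mul (x : ℝ) : ‖Complex.exp (2 * Real.pi * Complex.I * x)‖ = 1 := by
  have e : (2 * Real.pi * Complex.I * x : ℂ) = ((2 * Real.pi * x : ℝ) : ℂ) * Complex.I := by
    push_cast; ring
  rw [e, Complex.norm_exp_ofReal_mul_I]

theorem character_eq_zpow (k : ℤ) (x : ℝ) : (character k).toFun x =
    Complex.exp (2 * Real.pi * Complex.I * x) ^ k := by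
  rw [character_toFun, ← Complex.exp_int_mul]
  congr 1
  ring

theorem norm_character (k : ℤ) (x : ℝ) : ‖(character k).toFun x‖ = 1 := by
  rw [character_eq_zpow, norm_zpow, norm_exp_two_pi_mul, one_zpow]

theorem norm_exp_two_pi_mul_sub_le (x y : ℝ) :
    ‖Complex.exp (2 * Real.pi * Complex.I * x) - Complex.exp (2 * Real.pi * Complex.I * y)‖ ≤
      2 * Real.pi * |x - y| := by
  have e : Complex.exp (2 * Real.pi * Complex.I * x) - Complex.exp (2 * Real.pi * Complex.I * y) =
      Complex.exp (2 * Real.pi * Complex.I * y) *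
        (Complex.exp (Complex.I * ((2 * Real.pi * (x - y) : ℝ) : ℂ)) - 1) := by
    rw [mul_sub, ← Complex.exp_add, mul_one]
    congr 2
    push_cast
    ring
  rw [e, norm_mul, norm_exp_two_pi_mul, one_mul]
  refine (Real.norm_exp_I_mul_ofReal_sub_one_le).trans ?_
  rw [Real.norm_eq_abs, abs_mul, abs_of_pos (by positivity)]

theorem exists_exp_two_pi_mul_eq {z : ℂ} (hz : ‖z‖ = 1) :
    ∃ x : ℝ, Complex.exp (2 * Real.pi * Complex.I * x) = z := by
  refine ⟨z.arg / (2 * Real.pi), ?_⟩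
  have h := Complex.norm_mul_exp_arg_mul_I z
  rw [hz] at h
  rw [Complex.ofReal_one, one_mul] at h
  refine (congrArg Complex.exp ?_).trans h
  push_cast
  field_simp

/-- Bernstein's inequality, up to a constant and in Lipschitz form, for the moduli of
trigonometric polynomials. -/
theorem norm_trigSum_le_add {N : ℕ} (hN : 0 < N) (c : ℤ → ℂ) {M : ℝ}
    (h : ∀ x : ℝ, ‖∑ k ∈ Finset.Icc (-N : ℤ) N, c k * (character k).toFun x‖ ≤ M) (x y : ℝ) :
    ‖∑ k ∈ Finset.Icc (-N : ℤ) N, c k * (character k).toFun x‖ ≤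
      ‖∑ k ∈ Finset.Icc (-N : ℤ) N, c k * (character k).toFun y‖ +
        12 * Real.pi * N * M * |x - y| := by
  -- Shifting the frequencies by `N` gives a polynomial of degree at most `2N` with the same modulus
  -- on the circle. The constant is `12π N = 3 · 2N · 2π`, where `2π` is the Lipschitz constant of
  -- `u`.
  set a : ℕ → ℂ := fun i => c (i - N)
  set u : ℝ → ℂ := fun x => Complex.exp (2 * Real.pi * Complex.I * x) with hu
  have key : ∀ x : ℝ, ∑ k ∈ Finset.Icc (-N : ℤ) N, c k * (character k).toFun x =
      u x ^ (-N : ℤ) * ∑ i ∈ Finset.range (2 * N + 1), a i * u x ^ i := by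
    intro x
    rw [Finset.mul_sum]
    symm
    refine Finset.sum_bij (fun (i : ℕ) _ => (i : ℤ) - N) ?_ ?_ ?_ ?_
    · intro i hi
      simp only [Finset.mem_range, Finset.mem_Icc] at hi ⊢
      omega
    · intro i _ i' _ hii
      omega
    · intro k hk
      rw [Finset.mem_Icc] at hk
      exact ⟨(k + N).toNat, by simp only [Finset.mem_range]; omega, by omega⟩
    · intro i _
      rw [character_eq_zpow, zpow_sub₀ (Complex.exp_ne_zero _), zpow_natCast, zpow_natCast,
        zpow_neg, zpow_natCast]
      simp only [a, hu]
      ring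
  have hnorm : ∀ x : ℝ, ‖∑ k ∈ Finset.Icc (-N : ℤ) N, c k * (character k).toFun x‖ =
      ‖∑ i ∈ Finset.range (2 * N + 1), a i * u x ^ i‖ := by
    intro x
    rw [key, norm_mul, norm_zpow, norm_exp_two_pi_mul, one_zpow, one_mul]
  have hP : ∀ z : ℂ, ‖z‖ = 1 → ‖∑ i ∈ Finset.range (2 * N + 1), a i * z ^ i‖ ≤ M := by
    intro z hz
    obtain ⟨x, rfl⟩ := exists_exp_two_pi_mul_eq hz
    exact (hnorm x).symm.trans_le (h x)
  have hM : 0 ≤ M := (norm_nonneg _).trans (h 0)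
  rw [hnorm, hnorm]
  have h1 := norm_sum_mul_pow_sub_le (by omega : 0 < 2 * N) hP (norm_exp_two_pi_mul x).le
    (norm_exp_two_pi_mul y).le
  have h2 : 3 * ((2 * N : ℕ) : ℝ) * M * ‖u x - u y‖ ≤
      3 * ((2 * N : ℕ) : ℝ) * M * (2 * Real.pi * |x - y|) := by
    gcongr
    exact norm_exp_two_pi_mul_sub_le x y
  have h3 := norm_le_norm_add_norm_sub' (∑ i ∈ Finset.range (2 * N + 1), a i * u x ^ i)
    (∑ i ∈ Finset.range (2 * N + 1), a i * u y ^ i)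
  push_cast at h1 h2
  calc _ ≤ _ := h3
    _ ≤ _ + 3 * (2 * N) * M * (2 * Real.pi * |x - y|) := by gcongr; exact h1.trans h2
    _ = _ := by ring

/-! ### Dyadic blocks -/

theorem DyadicSystem.piece_nonneg (φ : DyadicSystem) (j : ℕ) (x : ℝ) : 0 ≤ φ.piece j x := by
  unfold DyadicSystem.piece
  split_ifs
  exacts [φ.low_nonneg x, φ.gen_nonneg _]

theorem DyadicSystem.piece_le_one (φ : DyadicSystem) (j : ℕ) (x : ℝ) : φ.piece j x ≤ 1 :=
  le_hasSum (φ.hasSum_one x) j fun i _ => φ.piece_nonneg i x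

theorem DyadicSystem.piece_eq_zero (φ : DyadicSystem) {j : ℕ} {x : ℝ} (h : 2 ^ (j + 1) < |x|) :
    φ.piece j x = 0 := by
  unfold DyadicSystem.piece
  split_ifs with hj
  · subst hj
    refine image_eq_zero_of_notMem_tsupport fun hx => ?_
    have : |x| ≤ 2 := φ.tsupport_low hx
    norm_num at h
    linarith
  · refine image_eq_zero_of_notMem_tsupport fun hx => ?_
    have h2 : |(2 : ℝ) ^ (-(j : ℤ)) * x| ≤ 2 := (φ.tsupport_gen hx).2
    rw [abs_mul, abs_of_pos (by positivity), zpow_neg, zpow_natCast,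
      inv_mul_le_iff₀ (by positivity)] at h2
    rw [pow_succ] at h
    linarith

theorem block_eq_sum (φ : DyadicSystem) (f : GenFun) (j : ℕ) (x : ℝ) :
    block φ f j x = ∑ k ∈ Finset.Icc (-(2 ^ (j + 1) : ℕ) : ℤ) (2 ^ (j + 1) : ℕ),
      ((φ.piece j k : ℂ) * fourierCoefficient f k) * (character k).toFun x := by
  refine tsum_eq_sum fun k hk => ?_
  rw [φ.piece_eq_zero]
  · simp
  · by_contra hc
    apply hk
    have h2 : |k| ≤ 2 ^ (j + 1) := by
      have : ((|k| : ℤ) : ℝ) ≤ ((2 ^ (j + 1) : ℤ) : ℝ) := by push_cast; exact not_lt.1 hc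
      exact_mod_cast this
    rw [Finset.mem_Icc]
    push_cast
    exact abs_le.1 h2

theorem continuous_block (φ : DyadicSystem) (f : GenFun) (j : ℕ) : Continuous (block φ f j) := by
  have e : block φ f j = fun x => _ := funext (block_eq_sum φ f j)
  rw [e]
  exact continuous_finsetSum _ fun k _ => continuous_const.mul (character k).contDiff.continuous

theorem block_periodic (φ : DyadicSystem) (f : GenFun) (j : ℕ) :
    Function.Periodic (block φ f j) 1 := by
  intro x
  simp_rw [block_eq_sum, fun k => (character k).periodic x]

instance : IsProbabilityMeasure torusMeasure := ⟨by simp [torusMeasure]⟩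

/-- By continuity the points of `(0, 1)` exceeding the essential supremum form an open null set,
hence none exist; closure and periodicity reach all of `ℝ`. -/
theorem enorm_block_le (φ : DyadicSystem) (f : GenFun) (j : ℕ) (x : ℝ) :
    ‖block φ f j x‖ₑ ≤ eLpNorm (block φ f j) ⊤ torusMeasure := by
  set C := eLpNorm (block φ f j) ⊤ torusMeasure with hC
  have hcl : IsClosed {y | ‖block φ f j y‖ₑ ≤ C} :=
    isClosed_le (continuous_block φ f j).enorm continuous_const
  have hae : ∀ᵐ y ∂(volume.restrict (Ioo (0 : ℝ) 1)), ‖block φ f j y‖ₑ ≤ C := by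
    rw [restrict_Ioo_eq_restrict_Ioc, hC, eLpNorm_exponent_top]
    exact enorm_ae_le_eLpNormEssSup _ _
  have hsub : Ioo (0 : ℝ) 1 ⊆ {y | ‖block φ f j y‖ₑ ≤ C} := by
    by_contra hn
    obtain ⟨y, hy, hyC⟩ := not_subset.1 hn
    have hop : IsOpen (Ioo (0 : ℝ) 1 ∩ {y | ‖block φ f j y‖ₑ ≤ C}ᶜ) :=
      isOpen_Ioo.inter hcl.isOpen_compl
    refine (hop.measure_pos volume ⟨y, hy, hyC⟩).ne' ?_
    rw [ae_restrict_iff' measurableSet_Ioo, ae_iff] at hae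
    convert hae using 2
    ext z
    simp [and_assoc]
  have hIcc : Icc (0 : ℝ) 1 ⊆ {y | ‖block φ f j y‖ₑ ≤ C} := by
    rw [← closure_Ioo zero_ne_one]
    exact hcl.closure_subset_iff.2 hsub
  obtain ⟨y, hy, hxy⟩ := (block_periodic φ f j).exists_mem_Ico₀ one_pos x
  rw [hxy]
  exact hIcc (Ico_subset_Icc_self hy)

theorem exists_forall_norm_block_le (φ : DyadicSystem) (f : GenFun) (j : ℕ) :
    ∃ x₀, ∀ x, ‖block φ f j x‖ ≤ ‖block φ f j x₀‖ := by
  obtain ⟨x₀, -, h⟩ := isCompact_Icc.exists_isMaxOn (nonempty_Icc.2 zero_le_one)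
    (continuous_block φ f j).norm.continuousOn (s := Icc (0 : ℝ) 1)
  refine ⟨x₀, fun x => ?_⟩
  obtain ⟨y, hy, hxy⟩ := (block_periodic φ f j).exists_mem_Ico₀ one_pos x
  rw [hxy]
  exact h (Ico_subset_Icc_self hy)

/-- Near a maximum point, at the scale `2⁻ʲ`, a dyadic block stays comparable to its maximum. -/
theorem norm_block_le_two_mul {φ : DyadicSystem} {f : GenFun} {j : ℕ} {x₀ : ℝ}
    (h : ∀ x, ‖block φ f j x‖ ≤ ‖block φ f j x₀‖) {x : ℝ} (hx : |x₀ - x| ≤ 1 / (200 * 2 ^ j)) :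
    ‖block φ f j x₀‖ ≤ 2 * ‖block φ f j x‖ := by
  simp_rw [block_eq_sum] at h ⊢
  have h1 := norm_trigSum_le_add (N := 2 ^ (j + 1)) (by positivity)
    (fun k => (φ.piece j k : ℂ) * fourierCoefficient f k) h x₀ x
  set M := ‖∑ k ∈ Finset.Icc (-(2 ^ (j + 1) : ℕ) : ℤ) (2 ^ (j + 1) : ℕ),
      ((φ.piece j k : ℂ) * fourierCoefficient f k) * (character k).toFun x₀‖
  have hM : 0 ≤ M := norm_nonneg _
  have h2 : 12 * Real.pi * ((2 ^ (j + 1) : ℕ) : ℝ) * M * |x₀ - x| ≤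
      12 * Real.pi * ((2 ^ (j + 1) : ℕ) : ℝ) * M * (1 / (200 * 2 ^ j)) := by gcongr
  -- The choice of `200` makes the oscillation at most `24π/200 · M < M/2`.
  have h3 : 12 * Real.pi * ((2 ^ (j + 1) : ℕ) : ℝ) * M * (1 / (200 * 2 ^ j)) =
      Real.pi * M * (24 / 200) := by
    push_cast
    field_simp
    ring
  have h4 : Real.pi * M ≤ 3.15 * M := by
    gcongr
    exact Real.pi_lt_d2.le
  linarith

/-! ### Growth of the Fourier coefficients -/

theorem iteratedDeriv_character (i : ℕ) (k : ℤ) :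
    iteratedDeriv i (character k).toFun =
      fun x => (2 * Real.pi * Complex.I * k) ^ i * (character k).toFun x := by
  induction i with
  | zero => simp
  | succ i ih =>
    rw [iteratedDeriv_succ, ih]
    ext x
    have h1 : HasDerivAt (fun y : ℝ => (2 * Real.pi * Complex.I * k) * (y : ℂ))
        (2 * Real.pi * Complex.I * k) x := by
      simpa using (Complex.ofRealCLM.hasDerivAt (x := x)).const_mul (2 * Real.pi * Complex.I * k : ℂ)
    have h2 := (h1.cexp.const_mul ((2 * Real.pi * Complex.I * k) ^ i)).deriv
    simp only [character_toFun]
    rw [h2]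
    ring

/-- The summand `1` keeps the base at least `1` even for `k = 0`, so that the bounds increase with
`i`. -/
theorem testSeminorm_character_le (i : ℕ) (k : ℤ) :
    testSeminorm i (character k) ≤ (2 * Real.pi * (1 + |(k : ℝ)|)) ^ i := by
  rw [testSeminorm_apply]
  refine ciSup_le fun x => ?_
  rw [iteratedDeriv_character, norm_mul, norm_character, mul_one, norm_pow]
  have e : ‖(2 * Real.pi * Complex.I * k : ℂ)‖ = 2 * Real.pi * |(k : ℝ)| := by
    simp [abs_of_pos Real.pi_pos]
  rw [e]
  gcongr
  linarith

/-- Continuity bounds `f` by finitely many seminorms; the highest order among them serves as the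
exponent `n`. -/
theorem exists_norm_fourierCoefficient_le (f : GenFun) :
    ∃ (C : ℝ) (n : ℕ), 0 ≤ C ∧ ∀ k, ‖fourierCoefficient f k‖ ≤ C * (1 + |(k : ℝ)|) ^ n := by
  have hcont : Continuous ((normSeminorm ℂ ℂ).comp f.toLinearMap) := f.continuous.norm
  obtain ⟨s, C, -, h⟩ := Seminorm.bound_of_continuous testFun_withSeminorms _ hcont
  refine ⟨C * (2 * Real.pi) ^ s.sup id, s.sup id, by positivity, fun k => ?_⟩
  have h1 : ‖fourierCoefficient f k‖ ≤ C * (s.sup testSeminorm) (character (-k)) :=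
    h (character (-k))
  refine h1.trans ?_
  rw [mul_assoc, ← mul_pow]
  refine mul_le_mul_of_nonneg_left ?_ C.coe_nonneg
  refine Seminorm.finset_sup_apply_le (by positivity) fun i hi => ?_
  refine (testSeminorm_character_le i (-k)).trans ?_
  rw [Int.cast_neg, abs_neg]
  refine pow_le_pow_right₀ ?_ (Finset.le_sup (f := id) hi)
  nlinarith [Real.pi_gt_three, abs_nonneg (k : ℝ)]

theorem exists_norm_block_le (φ : DyadicSystem) (f : GenFun) :
    ∃ (C : ℝ) (n : ℕ), ∀ j x, ‖block φ f j x‖ ≤ C * ((2 : ℝ) ^ j) ^ n := by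
  obtain ⟨C, n, hC, h⟩ := exists_norm_fourierCoefficient_le f
  -- There are `4 · 2^j + 1 ≤ 5 · 2^j` frequencies, which accounts for the extra power, and each
  -- satisfies `1 + |k| ≤ 3 · 2^j`.
  refine ⟨5 * (C * 3 ^ n), n + 1, fun j x => ?_⟩
  have h1 : (1 : ℝ) ≤ 2 ^ j := one_le_pow₀ (by norm_num)
  rw [block_eq_sum]
  refine (norm_sum_le_of_le (f := fun k : ℤ => ((φ.piece j k : ℂ) * fourierCoefficient f k) *
    (character k).toFun x) _ (n := fun _ => C * (3 * 2 ^ j) ^ n) fun k hk => ?_).trans ?_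
  · rw [Finset.mem_Icc, ← abs_le] at hk
    have hk' : |(k : ℝ)| ≤ 2 * 2 ^ j := by
      have : ((|k| : ℤ) : ℝ) ≤ (((2 ^ (j + 1) : ℕ) : ℤ) : ℝ) := by exact_mod_cast hk
      push_cast at this
      rwa [pow_succ, mul_comm] at this
    rw [norm_mul, norm_mul, norm_character, mul_one, Complex.norm_real, Real.norm_eq_abs,
      abs_of_nonneg (φ.piece_nonneg j k)]
    calc φ.piece j k * ‖fourierCoefficient f k‖ ≤ 1 * (C * (1 + |(k : ℝ)|) ^ n) :=
          mul_le_mul (φ.piece_le_one j k) (h k) (norm_nonneg _) zero_le_one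
      _ ≤ C * (3 * 2 ^ j) ^ n := by
          rw [one_mul]
          gcongr
          linarith
  · rw [Finset.sum_const, Int.card_Icc, nsmul_eq_mul]
    have e : (((((2 ^ (j + 1) : ℕ) : ℤ) + 1 - -((2 ^ (j + 1) : ℕ) : ℤ)).toNat : ℕ) : ℝ) =
        4 * 2 ^ j + 1 := by
      have e' : (((2 ^ (j + 1) : ℕ) : ℤ) + 1 - -((2 ^ (j + 1) : ℕ) : ℤ)).toNat = 4 * 2 ^ j + 1 := by
        rw [pow_succ]
        omega
      rw [e']
      push_cast
      ring
    rw [e]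
    calc (4 * 2 ^ j + 1) * (C * (3 * 2 ^ j) ^ n) ≤ (5 * 2 ^ j) * (C * (3 * 2 ^ j) ^ n) := by
          gcongr
          linarith
      _ = _ := by rw [mul_pow]; ring

/-! ### Embeddings -/

theorem besovNorm_le {φ : DyadicSystem} {f : GenFun} {p q : ℝ≥0∞} (hq : 0 < q) {s t : ℝ}
    {S : ℝ≥0∞} (hS : ∀ j : ℕ, (2 : ℝ≥0∞) ^ ((j : ℝ) * s) * eLpNorm (block φ f j) p torusMeasure ≤ S) :
    besovNorm φ p q t f ≤ seqNorm q (fun j => (2 : ℝ≥0∞) ^ ((j : ℝ) * (t - s))) * S :=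
  seqNorm_weight_le hq hS

theorem mem_besovSpace_of_lt {φ : DyadicSystem} {f : GenFun} {p q : ℝ≥0∞} (hq : 0 < q) {s t : ℝ}
    (hts : t < s) {S : ℝ≥0∞} (hS' : S < ⊤)
    (hS : ∀ j : ℕ, (2 : ℝ≥0∞) ^ ((j : ℝ) * s) * eLpNorm (block φ f j) p torusMeasure ≤ S) :
    f ∈ besovSpace φ p q t :=
  (besovNorm_le hq hS).trans_lt
    (ENNReal.mul_lt_top (seqNorm_two_rpow_lt_top hq (sub_neg.2 hts)) hS')

theorem mem_besovSpace_of_mem {φ : DyadicSystem} {f : GenFun} {p q r : ℝ≥0∞} (hq : 0 < q) (hr : 0 < r)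
    {s t : ℝ} (hts : t < s) (hf : f ∈ besovSpace φ p q s) : f ∈ besovSpace φ p r t :=
  mem_besovSpace_of_lt hr hts hf (le_seqNorm hq _)

theorem const_mul_eLpNorm {φ : DyadicSystem} {f : GenFun} {p : ℝ≥0∞} (hp : 0 < p) (hp' : p ≠ ⊤)
    (j : ℕ) (c : ℝ≥0∞) : c * eLpNorm (block φ f j) p torusMeasure =
      (∫⁻ x, (c * ‖block φ f j x‖ₑ) ^ p.toReal ∂torusMeasure) ^ (1 / p.toReal) := by
  have h0 : 0 < p.toReal := ENNReal.toReal_pos hp.ne' hp'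
  rw [eLpNorm_eq_lintegral_rpow_enorm_toReal hp.ne' hp']
  simp_rw [ENNReal.mul_rpow_of_nonneg _ _ h0.le]
  rw [lintegral_const_mul _ ((continuous_block φ f j).measurable.enorm.pow_const _),
    ENNReal.mul_rpow_of_nonneg _ _ (by positivity), one_div, ENNReal.rpow_rpow_inv h0.ne']

theorem weight_mul_eLpNorm_le_triebelLizorkinNorm {φ : DyadicSystem} {f : GenFun} {p q : ℝ≥0∞}
    (hp : 0 < p) (hp' : p ≠ ⊤) (hq : 0 < q) (s : ℝ) (j : ℕ) :
    (2 : ℝ≥0∞) ^ ((j : ℝ) * s) * eLpNorm (block φ f j) p torusMeasure ≤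
      triebelLizorkinNorm φ p q s f := by
  rw [const_mul_eLpNorm hp hp', triebelLizorkinNorm, if_neg hp']
  gcongr with x
  exact le_seqNorm hq (fun j : ℕ => (2 : ℝ≥0∞) ^ ((j : ℝ) * s) * ‖block φ f j x‖ₑ) j

theorem triebelLizorkinNorm_self {φ : DyadicSystem} {f : GenFun} {p : ℝ≥0∞}
    (hp : 0 < p) (hp' : p ≠ ⊤) (s : ℝ) :
    triebelLizorkinNorm φ p p s f = besovNorm φ p p s f := by
  have h0 : 0 < p.toReal := ENNReal.toReal_pos hp.ne' hp'
  rw [triebelLizorkinNorm, if_neg hp', besovNorm]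
  simp_rw [const_mul_eLpNorm hp hp', seqNorm, if_neg hp', one_div, ENNReal.rpow_inv_rpow h0.ne']
  rw [lintegral_tsum fun j =>
    (((continuous_block φ f j).measurable.enorm.const_mul _).pow_const _).aemeasurable]

theorem triebelLizorkinNorm_le {φ : DyadicSystem} {f : GenFun} {p q r : ℝ≥0∞}
    (hp : 0 < p) (hp' : p ≠ ⊤) (hq : 0 < q) (hr : 0 < r) {s t : ℝ} (hts : t < s) :
    triebelLizorkinNorm φ p q t f ≤
      seqNorm q (fun j => (2 : ℝ≥0∞) ^ ((j : ℝ) * (t - s))) * triebelLizorkinNorm φ p r s f := by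
  have h0 : 0 < p.toReal := ENNReal.toReal_pos hp.ne' hp'
  set K := seqNorm q (fun j => (2 : ℝ≥0∞) ^ ((j : ℝ) * (t - s)))
  have hK : K ≠ ⊤ := (seqNorm_two_rpow_lt_top hq (sub_neg.2 hts)).ne
  simp only [triebelLizorkinNorm, if_neg hp']
  calc _ ≤ (∫⁻ x, (K * seqNorm r fun j => (2 : ℝ≥0∞) ^ ((j : ℝ) * s) * ‖block φ f j x‖ₑ) ^ p.toReal
        ∂torusMeasure) ^ (1 / p.toReal) := by
        gcongr with x
        exact seqNorm_weight_le hq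
          (le_seqNorm hr fun j : ℕ => (2 : ℝ≥0∞) ^ ((j : ℝ) * s) * ‖block φ f j x‖ₑ)
    _ = _ := by
        simp_rw [ENNReal.mul_rpow_of_nonneg _ _ h0.le]
        rw [lintegral_const_mul' _ _ (ENNReal.rpow_ne_top_of_nonneg h0.le hK),
          ENNReal.mul_rpow_of_nonneg _ _ (by positivity), one_div, ENNReal.rpow_rpow_inv h0.ne']

/-! ### The Carleson-type norm at `p = ∞`. -/

theorem volume_dyadic (J : ℕ) (m : ℤ) :
    volume (Ioc ((m : ℝ) / 2 ^ J) (((m : ℝ) + 1) / 2 ^ J)) = ((2 : ℝ≥0∞) ^ J)⁻¹ := by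
  rw [Real.volume_Ioc, ← sub_div, add_sub_cancel_left, one_div, ENNReal.ofReal_inv_of_pos (by positivity),
    ENNReal.ofReal_pow zero_le_two, ENNReal.ofReal_ofNat]

theorem triebelLizorkinNorm_top_le {φ : DyadicSystem} {f : GenFun} {q : ℝ≥0∞}
    (hq : 0 < q) (hq' : q ≠ ⊤) {s t : ℝ} {S : ℝ≥0∞}
    (hS : ∀ (j : ℕ) x, (2 : ℝ≥0∞) ^ ((j : ℝ) * s) * ‖block φ f j x‖ₑ ≤ S) :
    triebelLizorkinNorm φ ⊤ q t f ≤
      seqNorm q (fun j => (2 : ℝ≥0∞) ^ ((j : ℝ) * (t - s))) * S := by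
  have h0 : 0 < q.toReal := ENNReal.toReal_pos hq.ne' hq'
  set K := seqNorm q (fun j => (2 : ℝ≥0∞) ^ ((j : ℝ) * (t - s)))
  rw [triebelLizorkinNorm, if_pos rfl, if_neg hq']
  refine iSup₂_le fun J m => ?_
  rw [one_div, ENNReal.rpow_inv_le_iff h0]
  have hpt : ∀ x, (∑' j : ℕ, if J ≤ j
      then ((2 : ℝ≥0∞) ^ ((j : ℝ) * t) * ‖block φ f j x‖ₑ) ^ q.toReal else 0) ≤
      (K * S) ^ q.toReal := by
    intro x
    have h1 := seqNorm_weight_le hq (t := t) fun j => hS j x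
    rw [seqNorm, if_neg hq', one_div, ENNReal.rpow_inv_le_iff h0] at h1
    refine (ENNReal.tsum_le_tsum fun j => ?_).trans h1
    split_ifs
    exacts [le_rfl, zero_le]
  calc _ ≤ (2 : ℝ≥0∞) ^ J * ∫⁻ _ in Ioc ((m : ℝ) / 2 ^ J) (((m : ℝ) + 1) / 2 ^ J),
        (K * S) ^ q.toReal := by
        gcongr with x
        exact hpt x
    _ = (2 : ℝ≥0∞) ^ J * ((2 : ℝ≥0∞) ^ J)⁻¹ * (K * S) ^ q.toReal := by
        rw [setLIntegral_const, volume_dyadic]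
        ring
    _ = (K * S) ^ q.toReal := by
        rw [ENNReal.mul_inv_cancel (by positivity) (by finiteness), one_mul]

/-- Every point of the line is an end point of an interval of length `2⁻ᴶ / 200` that lies in a
dyadic interval of length `2⁻ᴶ`. -/
theorem exists_subinterval_dyadic (J : ℕ) (x₀ : ℝ) :
    ∃ (m : ℤ) (a : ℝ), Ioc a (a + 1 / (200 * 2 ^ J)) ⊆
        Ioc ((m : ℝ) / 2 ^ J) (((m : ℝ) + 1) / 2 ^ J) ∧
      ∀ x ∈ Ioc a (a + 1 / (200 * 2 ^ J)), |x₀ - x| ≤ 1 / (200 * 2 ^ J) := by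
  have hJ : (0 : ℝ) < 2 ^ J := by positivity
  set m := ⌊x₀ * 2 ^ J⌋
  have h1 : (m : ℝ) ≤ x₀ * 2 ^ J := Int.floor_le _
  have h2 : x₀ * 2 ^ J < m + 1 := Int.lt_floor_add_one _
  have hδ : (0 : ℝ) < 1 / (200 * 2 ^ J) := by positivity
  have hm : (1 / (200 * 2 ^ J) : ℝ) * 2 ^ J = 1 / 200 := by field_simp
  -- The short interval extends from `x₀` towards the farther end of its dyadic interval.
  rcases le_total (x₀ * 2 ^ J) (m + 1 / 2) with h | h
  · refine ⟨m, x₀, Ioc_subset_Ioc ?_ ?_, fun x hx => ?_⟩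
    · rwa [div_le_iff₀ hJ]
    · rw [le_div_iff₀ hJ, add_mul, hm]
      linarith
    · rw [abs_le]
      constructor <;> linarith [hx.1, hx.2]
  · refine ⟨m, x₀ - 1 / (200 * 2 ^ J), Ioc_subset_Ioc ?_ ?_, fun x hx => ?_⟩
    · rw [div_le_iff₀ hJ, sub_mul, hm]
      linarith
    · rw [sub_add_cancel, le_div_iff₀ hJ]
      exact h2.le
    · rw [abs_le]
      constructor <;> linarith [hx.1, hx.2]

/-- Only the term `j = J` on one dyadic interval of level `J` is kept. The factor `2` comes from the
half-maximum, and `200 ^ (1/q)` from the share of the interval on which it is exceeded. -/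
theorem weight_mul_eLpNorm_top_le {φ : DyadicSystem} {f : GenFun} {q : ℝ≥0∞}
    (hq : 0 < q) (hq' : q ≠ ⊤) (s : ℝ) (J : ℕ) :
    (2 : ℝ≥0∞) ^ ((J : ℝ) * s) * eLpNorm (block φ f J) ⊤ torusMeasure ≤
      2 * (200 ^ (1 / q.toReal) * triebelLizorkinNorm φ ⊤ q s f) := by
  have h0 : 0 < q.toReal := ENNReal.toReal_pos hq.ne' hq'
  obtain ⟨x₀, hx₀⟩ := exists_forall_norm_block_le φ f J
  obtain ⟨m, a, hsub, hclose⟩ := exists_subinterval_dyadic J x₀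
  set T := triebelLizorkinNorm φ ⊤ q s f with hT
  set w : ℝ≥0∞ := (2 : ℝ≥0∞) ^ ((J : ℝ) * s)
  set A := ‖block φ f J x₀‖ₑ with hA
  have h1 : eLpNorm (block φ f J) ⊤ torusMeasure ≤ A := by
    refine (eLpNorm_le_of_ae_enorm_bound (C := A) (ae_of_all _ fun x => ?_)).trans ?_
    · exact enorm_le_iff_norm_le.2 (hx₀ x)
    · simp
  have h2 : ∀ x ∈ Ioc a (a + 1 / (200 * 2 ^ J)), A / 2 ≤ ‖block φ f J x‖ₑ := by
    intro x hx
    rw [ENNReal.div_le_iff' (by norm_num) (by norm_num)]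
    have := norm_block_le_two_mul hx₀ (hclose x hx)
    rw [hA, ← ofReal_norm, ← ofReal_norm, ← ENNReal.ofReal_ofNat 2,
      ← ENNReal.ofReal_mul zero_le_two]
    exact ENNReal.ofReal_le_ofReal this
  have h3 : ((2 : ℝ≥0∞) ^ J *
        ∫⁻ x in Ioc ((m : ℝ) / 2 ^ J) (((m : ℝ) + 1) / 2 ^ J),
          ∑' j : ℕ, if J ≤ j
            then ((2 : ℝ≥0∞) ^ ((j : ℝ) * s) * ‖block φ f j x‖ₑ) ^ q.toReal else 0)
        ^ (1 / q.toReal) ≤ T := by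
    rw [hT, triebelLizorkinNorm, if_pos rfl, if_neg hq']
    exact le_iSup₂ (f := fun (J : ℕ) (m : ℤ) => ((2 : ℝ≥0∞) ^ J *
        ∫⁻ x in Ioc ((m : ℝ) / 2 ^ J) (((m : ℝ) + 1) / 2 ^ J),
          ∑' j : ℕ, if J ≤ j
            then ((2 : ℝ≥0∞) ^ ((j : ℝ) * s) * ‖block φ f j x‖ₑ) ^ q.toReal else 0)
        ^ (1 / q.toReal)) J m
  have hvol : volume (Ioc a (a + 1 / (200 * 2 ^ J))) = (200 : ℝ≥0∞)⁻¹ * ((2 : ℝ≥0∞) ^ J)⁻¹ := by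
    rw [Real.volume_Ioc, add_sub_cancel_left, one_div, mul_inv,
      ENNReal.ofReal_mul (by positivity), ENNReal.ofReal_inv_of_pos (by positivity),
      ENNReal.ofReal_inv_of_pos (by positivity), ENNReal.ofReal_pow zero_le_two,
      ENNReal.ofReal_ofNat, ENNReal.ofReal_ofNat]
  have h4 : (w * (A / 2)) ^ q.toReal * (200 : ℝ≥0∞)⁻¹ ≤ T ^ q.toReal := by
    rw [one_div, ENNReal.rpow_inv_le_iff h0] at h3
    refine le_trans ?_ h3
    calc (w * (A / 2)) ^ q.toReal * (200 : ℝ≥0∞)⁻¹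
        = (2 : ℝ≥0∞) ^ J * ((2 : ℝ≥0∞) ^ J)⁻¹ * ((w * (A / 2)) ^ q.toReal * (200 : ℝ≥0∞)⁻¹) := by
          rw [ENNReal.mul_inv_cancel (by positivity) (by finiteness), one_mul]
      _ = (2 : ℝ≥0∞) ^ J * ∫⁻ _ in Ioc a (a + 1 / (200 * 2 ^ J)), (w * (A / 2)) ^ q.toReal := by
          rw [setLIntegral_const, hvol]
          ring
      _ ≤ (2 : ℝ≥0∞) ^ J * ∫⁻ x in Ioc a (a + 1 / (200 * 2 ^ J)),
          ∑' j : ℕ, if J ≤ j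
            then ((2 : ℝ≥0∞) ^ ((j : ℝ) * s) * ‖block φ f j x‖ₑ) ^ q.toReal else 0 := by
          refine mul_le_mul_right (setLIntegral_mono' measurableSet_Ioc fun x hx => ?_) _
          refine le_trans ?_ (ENNReal.le_tsum J)
          rw [if_pos le_rfl]
          gcongr
          exact h2 x hx
      _ ≤ _ := by
          gcongr
  have h5 : w * (A / 2) ≤ 200 ^ (1 / q.toReal) * T := by
    rw [← ENNReal.rpow_le_rpow_iff h0, ENNReal.mul_rpow_of_nonneg _ T h0.le, one_div,
      ENNReal.rpow_inv_rpow h0.ne']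
    rwa [← div_eq_mul_inv, ENNReal.div_le_iff' (by norm_num) (by norm_num)] at h4
  calc w * eLpNorm (block φ f J) ⊤ torusMeasure ≤ w * A := by gcongr
    _ = 2 * (w * (A / 2)) := by
        rw [mul_left_comm, ENNReal.mul_div_cancel (by norm_num) (by norm_num)]
    _ ≤ _ := by gcongr

theorem mem_besovSpace_of_mem_triebelLizorkinSpace {φ : DyadicSystem} {f : GenFun} {p q : ℝ≥0∞}
    (hp : 0 < p) (hq : 0 < q) {s t : ℝ} (hts : t < s)
    (hf : f ∈ triebelLizorkinSpace φ p q s) : f ∈ besovSpace φ p q t := by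
  by_cases hp' : p = ⊤
  · subst hp'
    by_cases hq' : q = ⊤
    · subst hq'
      have hf' : besovNorm φ ⊤ ⊤ s f < ⊤ := by
        simpa [triebelLizorkinSpace, triebelLizorkinNorm] using hf
      exact mem_besovSpace_of_mem hq hq hts hf'
    · refine mem_besovSpace_of_lt hq hts ?_ (weight_mul_eLpNorm_top_le hq hq' s)
      exact ENNReal.mul_lt_top (by norm_num) (ENNReal.mul_lt_top (by finiteness) hf)
  · exact mem_besovSpace_of_lt hq hts hf (weight_mul_eLpNorm_le_triebelLizorkinNorm hp hp' hq s)

theorem mem_triebelLizorkinSpace_of_mem_besovSpace {φ : DyadicSystem} {f : GenFun} {p q : ℝ≥0∞}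
    (hp : 0 < p) (hq : 0 < q) {s t : ℝ} (hts : t < s)
    (hf : f ∈ besovSpace φ p q s) : f ∈ triebelLizorkinSpace φ p q t := by
  by_cases hp' : p = ⊤
  · subst hp'
    by_cases hq' : q = ⊤
    · subst hq'
      have := mem_besovSpace_of_mem hq hq hts hf
      simpa [triebelLizorkinSpace, triebelLizorkinNorm, besovSpace] using this
    · refine (triebelLizorkinNorm_top_le hq hq' (s := s) (S := besovNorm φ ⊤ q s f)
        fun j x => ?_).trans_lt
        (ENNReal.mul_lt_top (seqNorm_two_rpow_lt_top hq (sub_neg.2 hts)) hf)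
      refine le_trans ?_ (le_seqNorm hq _ j)
      gcongr
      exact enorm_block_le φ f j x
  -- The route is `B^s_{p,q} ⊆ B^r_{p,p} = F^r_{p,p} ⊆ F^t_{p,q}`; each change of fine index uses up
  -- some smoothness.
  · obtain ⟨r, htr, hrs⟩ := exists_between hts
    refine (triebelLizorkinNorm_le hp hp' hq hp htr).trans_lt
      (ENNReal.mul_lt_top (seqNorm_two_rpow_lt_top hq (sub_neg.2 htr)) ?_)
    rw [triebelLizorkinNorm_self hp hp']
    exact mem_besovSpace_of_mem hq hp hrs hf

theorem exists_mem_besovSpace (φ : DyadicSystem) (f : GenFun) (p : ℝ≥0∞) {q : ℝ≥0∞} (hq : 0 < q) :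
    ∃ s, f ∈ besovSpace φ p q s := by
  obtain ⟨C, n, h⟩ := exists_norm_block_le φ f
  -- Smoothness `-n` cancels the growth of the blocks; one unit less makes the sequence
  -- `ℓ_q`-summable.
  refine ⟨-n - 1, mem_besovSpace_of_lt hq (s := -n) (by linarith)
    (S := ENNReal.ofReal C) ENNReal.ofReal_lt_top fun j => ?_⟩
  have h1 : eLpNorm (block φ f j) p torusMeasure ≤ ENNReal.ofReal (C * ((2 : ℝ) ^ j) ^ n) := by
    refine (eLpNorm_le_of_ae_bound (ae_of_all _ (h j))).trans ?_
    simp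
  have e : ENNReal.ofReal (((2 : ℝ) ^ j) ^ n) = (2 : ℝ≥0∞) ^ ((j : ℝ) * n) := by
    rw [← pow_mul, ENNReal.ofReal_pow zero_le_two, ENNReal.ofReal_ofNat, ← ENNReal.rpow_natCast]
    push_cast
    rfl
  rw [ENNReal.ofReal_mul' (by positivity), e] at h1
  calc _ ≤ (2 : ℝ≥0∞) ^ ((j : ℝ) * -n) * (ENNReal.ofReal C * (2 : ℝ≥0∞) ^ ((j : ℝ) * n)) := by
        gcongr
    _ = ENNReal.ofReal C * (2 : ℝ≥0∞) ^ ((j : ℝ) * -n + (j : ℝ) * n) := by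
        rw [two_rpow_add]
        ring
    _ = ENNReal.ofReal C := by
        rw [mul_neg, neg_add_cancel, ENNReal.rpow_zero, mul_one]

/-- Each `s ∈ A` is the supremum of the reals below it, all of which lie in `B`. -/
theorem sSup_coe_image_le {A B : Set ℝ} (h : ∀ s ∈ A, ∀ t < s, t ∈ B) :
    sSup ((fun s : ℝ => (s : EReal)) '' A) ≤ sSup ((fun s : ℝ => (s : EReal)) '' B) := by
  refine sSup_le ?_
  rintro _ ⟨s, hs, rfl⟩
  refine EReal.ge_of_forall_gt_iff_ge.1 fun t ht => ?_
  exact le_sSup ⟨t, h s hs t (EReal.coe_lt_coe_iff.1 ht), rfl⟩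

end PeriodicSpaces

theorem mainTheorem8 (φ : PeriodicSpaces.DyadicSystem) (f : PeriodicSpaces.GenFun)
    (p q : ENNReal) (hp : 0 < p) (hq : 0 < q) :
    ⊥ < PeriodicSpaces.triebelLizorkinCritical φ f p q ∧
    PeriodicSpaces.triebelLizorkinCritical φ f p q = PeriodicSpaces.besovCritical φ f p q ∧
    PeriodicSpaces.besovCritical φ f p q = PeriodicSpaces.criticalSmoothness φ f p := by
  refine ⟨?_, le_antisymm ?_ ?_, le_antisymm ?_ ?_⟩
  · obtain ⟨s, hs⟩ := PeriodicSpaces.exists_mem_besovSpace φ f p hq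
    refine (EReal.bot_lt_coe (s - 1)).trans_le (le_sSup ⟨s - 1, ?_, rfl⟩)
    exact PeriodicSpaces.mem_triebelLizorkinSpace_of_mem_besovSpace hp hq (by linarith) hs
  · exact PeriodicSpaces.sSup_coe_image_le fun s hs t hts =>
      PeriodicSpaces.mem_besovSpace_of_mem_triebelLizorkinSpace hp hq hts hs
  · exact PeriodicSpaces.sSup_coe_image_le fun s hs t hts =>
      PeriodicSpaces.mem_triebelLizorkinSpace_of_mem_besovSpace hp hq hts hs
  · exact PeriodicSpaces.sSup_coe_image_le fun s hs t hts =>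
      PeriodicSpaces.mem_besovSpace_of_mem hq hp hts hs
  · exact PeriodicSpaces.sSup_coe_image_le fun s hs t hts =>
      PeriodicSpaces.mem_besovSpace_of_mem hp hq hts hs
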